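/- An \emph{arc} is an arc of a great circle of the unit sphere $S^2\subset\mathbb R^3$ of positive length. An arc $a$ \emph{feeds into} an arc $b$ if an endpoint of $a$ lies in the relative interior of $b$. A \emph{Spherical Occlusion Diagram} (SOD) is a finite non-empty set $\mathcal S$ of arcs such that: (A1') each arc is shorter than a great semicircle, and any two distinct arcs have disjoint relative interiors; (A2) each arc of $\mathcal S$ feeds into exactly two arcs of $\mathcal S$; (A3) all arcs of $\mathcal S$ that feed into the same arc reach it from the same side. A \emph{swirl} of $\mathcal S$ is a cycle of distinct arcs of $\mathcal S$, each feeding into the next, such that, when one follows the cycle, all the turns from an arc into the next one are to the left (counterclockwise swirl) or all are to the right (clockwise swirl). The \emph{eye} of a swirl is the closed spherically convex region enclosed by it, that is, the set of points of $S^2$ that, for every arc of the swirl, lie on the great circle of that arc or on the side of it towards which the swirl turns (the left side, in the direction of travel, for a counterclockwise swirl, the right side for a clockwise one). Let $\mathcal S$ be a SOD. Then for every unit vector $h\in\mathbb R^3$ there is a swirl of $\mathcal S$ whose eye is contained in the open hemisphere $\{x\in S^2 : \langle h,x\rangle>0\}$ (and hence also in the closed hemisphere centred at $h$). -/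

import Mathlib

namespace SphericalOcclusion

/-- Euclidean three-space; the diagrams live on its unit sphere. -/
abbrev E3 : Type := EuclideanSpace ℝ (Fin 3)

/-- The triple product `u · (v × w)`. For unit vectors `u ≠ ± v`, the points `x` of the sphere with
`0 < triple u v x` are those strictly to the left (seen from outside the sphere) of the great circle
through `u` and `v`, directed from `u` towards `v` along the shorter way. -/
def triple (u v w : E3) : ℝ :=
  Matrix.det !![u 0, u 1, u 2; v 0, v 1, v 2; w 0, w 1, w 2]

/-- An arc of a great circle of the unit sphere, of positive length and strictly shorter than a
great semicircle. Such an arc is given by its two endpoints, which are neither equal nor antipodal.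
The order in which the endpoints are listed has no significance. -/
structure Arc where
  fst : E3
  snd : E3
  norm_fst : ‖fst‖ = 1
  norm_snd : ‖snd‖ = 1
  ne : fst ≠ snd
  ne_neg : fst ≠ -snd

/-- The two endpoints of an arc. -/
def Arc.endpoints (a : Arc) : Set E3 := {a.fst, a.snd}

/-- The relative interior of an arc: the points of the sphere in the open cone spanned by the two
endpoints. -/
def Arc.interior (a : Arc) : Set E3 :=
  {x | ‖x‖ = 1 ∧ ∃ s t : ℝ, 0 < s ∧ 0 < t ∧ x = s • a.fst + t • a.snd}

/-- `a` feeds into `b`: an endpoint of `a` is in the relative interior of `b`. -/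
def Arc.FeedsInto (a b : Arc) : Prop := ∃ x ∈ a.endpoints, x ∈ b.interior

/-- The open left side of the great circle containing the arc `b` (directed from the first endpoint
to the second one). -/
def Arc.leftSide (b : Arc) : Set E3 := {x | 0 < triple b.fst b.snd x}

/-- The open right side of the great circle containing the arc `b`. -/
def Arc.rightSide (b : Arc) : Set E3 := {x | triple b.fst b.snd x < 0}

/-- Spherical Occlusion Diagrams: finite nonempty sets of arcs of great circles, each shorter than a
great semicircle (this is part of `Arc`), satisfying the diagram axioms. -/
structure IsSOD (S : Set Arc) : Prop where
  finite : S.Finite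
  nonempty : S.Nonempty
  /-- Any two arcs are internally disjoint. -/
  internally_disjoint : ∀ a ∈ S, ∀ b ∈ S, a ≠ b → Disjoint a.interior b.interior
  /-- Each arc feeds into two arcs. -/
  feeds_two : ∀ a ∈ S, {b | b ∈ S ∧ a.FeedsInto b}.ncard = 2
  /-- All arcs that feed into the same arc reach it from the same side. An arc which ends on `b`,
  not being longer than a semicircle, reaches `b` from one side exactly if its relative interior
  lies on that side of the great circle of `b`. -/
  same_side : ∀ b ∈ S,
    (∀ a ∈ S, a.FeedsInto b → a.interior ⊆ b.leftSide) ∨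
    (∀ a ∈ S, a.FeedsInto b → a.interior ⊆ b.rightSide)

/-- A swirl of `S`: a cycle of (distinct) arcs of `S` such that each arc feeds into the next, going
always counterclockwise (`orient = 1`) or always clockwise (`orient = -1`). Indices are cyclic. -/
structure Swirl (S : Set Arc) where
  length : ℕ
  [length_ne_zero : NeZero length]
  arc : Fin length → Arc
  arc_mem : ∀ i, arc i ∈ S
  arc_injective : Function.Injective arc
  /-- `tip i` is the endpoint at which the `i`-th arc feeds into the next one. -/
  tip : Fin length → E3
  tip_endpoint : ∀ i, tip i ∈ (arc i).endpoints
  tip_interior : ∀ i, tip i ∈ (arc (i + 1)).interior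
  orient : ℝ
  orient_eq : orient = 1 ∨ orient = -1
  /-- One goes along the arc `i + 1` from `tip i` to `tip (i + 1)`, and turns there into the arc
  `i + 2`, towards `tip (i + 2)`. All these turns are to the left if `orient = 1`, and to the right
  if `orient = -1`. -/
  turn : ∀ i, 0 < orient * triple (tip i) (tip (i + 1)) (tip (i + 1 + 1))

attribute [instance] Swirl.length_ne_zero

/-- The eye of a swirl: the closed spherically convex region enclosed by it, that is, the spherical
polygon whose sides are the portions of the arcs `i + 1` from `tip i` to `tip (i + 1)`. It consists
of the points of the sphere that lie, for each of the sides, on the inner side of (or on) the great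
circle of that side; the inner side is the left one for a counterclockwise swirl, and the right one
for a clockwise swirl. -/
def Swirl.eye {S : Set Arc} (W : Swirl S) : Set E3 :=
  {x | ‖x‖ = 1 ∧ ∀ i, 0 ≤ W.orient * triple (W.tip i) (W.tip (i + 1)) x}

/-- The open hemisphere centred at the point `h` of the unit sphere. -/
def openHemisphere (h : E3) : Set E3 := {x | ‖x‖ = 1 ∧ 0 < inner ℝ h x}

end SphericalOcclusion

namespace SphericalOcclusion

/-! Direct every arc so that the others reach it from its left. At the head `q` of an arc, a walk
reaches the next arc from the left and follows it to its own head, hence turns left; walking from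
tail `p` to tail gives only right turns. An endless walk of one kind repeats, by finiteness, and so
contains a swirl. It remains to find such a walk with all its turning points in the open hemisphere
H centred at `h`.

Suppose that there is none. Among the arcs with an end in H, take one, `c`, from which the fewest
arcs can be reached by moves (along an arc to an end in H, then onto the arc met there). The
tail-to-tail walk from `c` gets to an arc `a` whose tail is not in H. The head-to-head walk from `a`
comes into H along `a` and also leaves it. The part of H to the left of all its arcs is convex, and
within H its boundary is covered by arcs of the walk. By disjointness, no arc crosses this boundary
inside H, so moves starting at `f a` never enter the region (`outside_of_move`). A move onto `a`
would come from inside it, so `a` cannot be reached from `f a`: fewer arcs are reachable from `f a`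
than from `c`, a contradiction.

Two facts complete the proof: some arc has an end in H (`IsSOD.exists_inner_pos`), and a closed
polygon with vertices in H and all turns to one side has its inner region in H
(`inner_pos_of_polygon`). -/

theorem triple_eq (u v w : E3) : triple u v w =
    u 0 * (v 1 * w 2 - v 2 * w 1) - u 1 * (v 0 * w 2 - v 2 * w 0)
      + u 2 * (v 0 * w 1 - v 1 * w 0) := by
  simp only [triple, Matrix.det_fin_three, Matrix.of_apply, Matrix.cons_val', Matrix.cons_val_zero,
    Matrix.cons_val_one, Matrix.cons_val]
  ring

theorem triple_comb (u v x y : E3) (s t : ℝ) :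
    triple u v (s • x + t • y) = s * triple u v x + t * triple u v y := by
  simp only [triple_eq, PiLp.add_apply, PiLp.smul_apply, smul_eq_mul]; ring

theorem triple_comb_mid (u v x y : E3) (s t : ℝ) :
    triple u (s • x + t • y) v = s * triple u x v + t * triple u y v := by
  simp only [triple_eq, PiLp.add_apply, PiLp.smul_apply, smul_eq_mul]; ring

theorem triple_smul (u v x : E3) (s : ℝ) : triple u v (s • x) = s * triple u v x := by
  simp only [triple_eq, PiLp.smul_apply, smul_eq_mul]; ring

theorem triple_rotate (u v w : E3) : triple u v w = triple v w u := by
  simp only [triple_eq]; ring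

theorem triple_swap (u v w : E3) : triple u v w = -triple v u w := by
  simp only [triple_eq]; ring

theorem triple_self_left (u v : E3) : triple u v u = 0 := by
  simp only [triple_eq]; ring

theorem triple_self_right (u v : E3) : triple u v v = 0 := by
  simp only [triple_eq]; ring

/-- Cramer's rule in homogeneous form: the signs of three triple products locate `x` relative to the
cone over `u`, `v`, `w`, with no independence assumed. -/
theorem cramer (u v w x : E3) : triple u v w • x =
    triple v w x • u + triple w u x • v + triple u v x • w := by
  ext i
  fin_cases i <;>
  · simp only [triple_eq, PiLp.add_apply, PiLp.smul_apply, smul_eq_mul, Fin.zero_eta, Fin.mk_one,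
      Fin.reduceFinMk]
    ring

theorem inner_comb (h x y : E3) (s t : ℝ) :
    inner ℝ h (s • x + t • y) = s * inner ℝ h x + t * inner ℝ h y := by
  rw [inner_add_right, real_inner_smul_right, real_inner_smul_right]

/-- Three vectors in a plane through the origin have triple product zero. -/
theorem triple_eq_zero_of_inner_eq_zero {h u v w : E3} (hh : h ≠ 0) (hu : inner ℝ h u = 0)
    (hv : inner ℝ h v = 0) (hw : inner ℝ h w = 0) : triple u v w = 0 := by
  have := congrArg (inner ℝ h) (cramer u v w h)
  rw [inner_add_right, inner_add_right] at this
  simp only [real_inner_smul_right, hu, hv, hw, mul_zero, add_zero] at this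
  exact (mul_eq_zero.mp this).resolve_right (inner_self_ne_zero.mpr hh)

/-! ### Locally convex polygons in a hemisphere -/

/-- A linear functional which, relative to `h`, is maximal over a locally convex closed polygon at
one vertex, bounds every point on the inner side of all edges. -/
theorem inner_le_of_polygon {n : ℕ} [NeZero n] (v : Fin n → E3) (o : ℝ) (h x u : E3)
    (hv : ∀ i, 0 < inner ℝ h (v i))
    (turn : ∀ i, 0 < o * triple (v i) (v (i + 1)) (v (i + 1 + 1)))
    (hx : ∀ i, 0 ≤ o * triple (v i) (v (i + 1)) x) :
    ∃ M : ℝ, (∀ i, inner ℝ u (v i) ≤ M * inner ℝ h (v i)) ∧ inner ℝ u x ≤ M * inner ℝ h x := by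
  obtain ⟨j, -, hj⟩ := Finset.exists_max_image (Finset.univ : Finset (Fin n))
    (fun i => inner ℝ u (v i) / inner ℝ h (v i)) ⟨0, Finset.mem_univ _⟩
  set M := (inner ℝ u (v j) : ℝ) / inner ℝ h (v j) with hM
  have hle : ∀ i, inner ℝ u (v i) ≤ M * inner ℝ h (v i) := fun i =>
    (div_le_iff₀ (hv i)).mp (hj i (Finset.mem_univ _))
  have hjeq : inner ℝ u (v j) = M * inner ℝ h (v j) := (div_mul_cancel₀ _ (hv j).ne').symm
  refine ⟨M, hle, ?_⟩
  -- Only the two edges at the maximal vertex are used: `x` is a combination of this vertex and its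
  -- neighbours, with nonnegative coefficients at the neighbours. No global simplicity of the
  -- polygon is needed.
  obtain ⟨k, rfl⟩ : ∃ k, k + 1 = j := ⟨j - 1, by simp⟩
  have hc := cramer (v k) (v (k + 1)) (v (k + 1 + 1)) x
  have hcu := congrArg (inner ℝ u) hc
  have hch := congrArg (inner ℝ h) hc
  simp only [inner_add_right, real_inner_smul_right] at hcu hch
  have h1 := mul_le_mul_of_nonneg_left (hle k) (hx (k + 1))
  have h2 := mul_le_mul_of_nonneg_left (hle (k + 1 + 1)) (hx k)
  refine le_of_mul_le_mul_left ?_ (turn k)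
  rw [hjeq] at hcu
  linear_combination h1 + h2 + o * hcu - o * M * hch

/-- A closed polygon with vertices in an open hemisphere, turning always to the same side, has its
inner region in that hemisphere. -/
theorem inner_pos_of_polygon {n : ℕ} [NeZero n] (v : Fin n → E3) (o : ℝ) (h x : E3)
    (hv : ∀ i, 0 < inner ℝ h (v i))
    (turn : ∀ i, 0 < o * triple (v i) (v (i + 1)) (v (i + 1 + 1)))
    (hx : ∀ i, 0 ≤ o * triple (v i) (v (i + 1)) x) (hx0 : x ≠ 0) : 0 < inner ℝ h x := by
  by_contra! hneg
  have key : ∀ i, (inner ℝ h x : ℝ) • v i = (inner ℝ h (v i) : ℝ) • x := by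
    intro i
    rw [← sub_eq_zero]
    set w := (inner ℝ h x : ℝ) • v i - (inner ℝ h (v i) : ℝ) • x with hw
    -- The vector `w` is orthogonal to `h`. Testing with `-w` cancels `M` and leaves `⟪w, w⟫ ≤ 0`.
    obtain ⟨M, h1, h2⟩ := inner_le_of_polygon v o h x (-w) hv turn hx
    have h3 := mul_le_mul_of_nonpos_right (h1 i) hneg
    have h4 := mul_le_mul_of_nonneg_right h2 (hv i).le
    have h5 : inner ℝ (-w) w = inner ℝ h x * inner ℝ (-w) (v i)
        - inner ℝ h (v i) * inner ℝ (-w) x := by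
      conv_lhs => rw [hw]
      rw [inner_sub_right, real_inner_smul_right, real_inner_smul_right]
    rw [inner_neg_left] at h5
    have h6 : inner ℝ w w ≤ 0 := by linarith
    exact real_inner_self_nonpos.mp h6
  -- If `⟪h, x⟫ = 0`, then `key` forces `x = 0`. Otherwise all vertices are parallel to `x`, and the
  -- turns vanish.
  rcases hneg.eq_or_lt with h0 | hlt
  · have := key 0
    rw [h0, zero_smul, eq_comm, smul_eq_zero] at this
    exact this.elim (hv 0).ne' hx0
  · have t1 : inner ℝ h x * triple (v 0) (v (0 + 1)) (v (0 + 1 + 1)) =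
        inner ℝ h (v 0) * triple x (v (0 + 1)) (v (0 + 1 + 1)) := by
      rw [triple_rotate (v 0), triple_rotate x, ← triple_smul, ← triple_smul, key 0]
    have t2 : inner ℝ h x * triple x (v (0 + 1)) (v (0 + 1 + 1)) = 0 := by
      rw [← triple_rotate, ← triple_smul, key (0 + 1), triple_smul, triple_self_right, mul_zero]
    have t3 := (mul_eq_zero.mp t2).resolve_left hlt.ne
    rw [t3, mul_zero] at t1
    have t4 := (mul_eq_zero.mp t1).resolve_left hlt.ne
    have := turn 0
    rw [t4, mul_zero] at this
    exact lt_irrefl _ this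

/-- Along a segment from a point where finitely many affine functions are nonnegative to a point
where one of them is not positive, there is a first zero. -/
theorem exists_first_zero {α : Type*} (J : Finset α) (A B : α → ℝ) (hA : ∀ j ∈ J, 0 ≤ A j)
    (hB : ∃ i ∈ J, B i ≤ 0) : ∃ μ : ℝ, 0 ≤ μ ∧ μ ≤ 1 ∧
      (∀ j ∈ J, 0 ≤ (1 - μ) * A j + μ * B j) ∧ ∃ i ∈ J, B i ≤ 0 ∧ (1 - μ) * A i + μ * B i = 0 := by
  by_cases hall : ∀ j ∈ J, 0 ≤ B j
  · obtain ⟨i, hi, hiB⟩ := hB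
    refine ⟨1, zero_le_one, le_rfl, fun j hj => by simpa using hall j hj, i, hi, hiB, ?_⟩
    simpa using le_antisymm hiB (hall i hi)
  · push Not at hall
    obtain ⟨i₀, hi₀, hi₀B⟩ := hall
    -- `A j / (A j - B j)` is the parameter at which the `j`-th function vanishes.
    obtain ⟨i, hi, hmin⟩ := Finset.exists_min_image (J.filter fun j => B j < 0)
      (fun j => A j / (A j - B j)) ⟨i₀, by simp [hi₀, hi₀B]⟩
    rw [Finset.mem_filter] at hi
    have hAi := hA i hi.1
    have hd : 0 < A i - B i := by linarith [hi.2]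
    have hμ0 : 0 ≤ A i / (A i - B i) := by positivity
    have hμ1 : A i / (A i - B i) ≤ 1 := (div_le_one hd).mpr (by linarith [hi.2])
    refine ⟨A i / (A i - B i), hμ0, hμ1, fun j hj => ?_, i, hi.1, hi.2.le, ?_⟩
    · rcases le_or_gt 0 (B j) with hBj | hBj
      · have := hA j hj
        have := sub_nonneg.mpr hμ1
        positivity
      · have h1 := hmin j (by simp [hj, hBj])
        have hdj : 0 < A j - B j := by linarith [hA j hj]
        have := (le_div_iff₀ hdj).mp h1
        linarith
    · field_simp
      ring

/-! ### Arcs as open cones, directed so as to be reached from the left -/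

/-- The open cone spanned by two vectors. -/
def openCone (u v : E3) : Set E3 := {x | ∃ s t : ℝ, 0 < s ∧ 0 < t ∧ x = s • u + t • v}

/-- A segment from the closed cone to a point of the open cone stays, after its start, in the open
cone. -/
theorem openCone_segment {u v a b : E3} {μ : ℝ} (h0 : 0 < μ) (h1 : μ ≤ 1) {s t : ℝ} (hs : 0 ≤ s)
    (ht : 0 ≤ t) (ha : a = s • u + t • v) (hb : b ∈ openCone u v) :
    (1 - μ) • a + μ • b ∈ openCone u v := by
  obtain ⟨s', t', hs', ht', rfl⟩ := hb
  have := sub_nonneg.mpr h1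
  refine ⟨(1 - μ) * s + μ * s', (1 - μ) * t + μ * t', by positivity, by positivity, ?_⟩
  rw [ha]; module

theorem openCone_smul {u v x : E3} {c : ℝ} (hc : 0 < c) (hx : x ∈ openCone u v) :
    c • x ∈ openCone u v := by
  obtain ⟨s, t, hs, ht, rfl⟩ := hx
  exact ⟨c * s, c * t, by positivity, by positivity, by module⟩

/-- A system of internally disjoint arcs, described by the open cones over their interiors. The
arc `i` is directed from `p i` to `q i`, its two ends lie on the arcs `g i` and `f i`, and arcs are
reached from the left only. -/
structure DirectedDiagram (ι : Type*) where
  p : ι → E3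
  q : ι → E3
  f : ι → ι
  g : ι → ι
  q_mem : ∀ i, q i ∈ openCone (p (f i)) (q (f i))
  p_mem : ∀ i, p i ∈ openCone (p (g i)) (q (g i))
  left_f : ∀ i, ∀ x ∈ openCone (p i) (q i), 0 < triple (p (f i)) (q (f i)) x
  left_g : ∀ i, ∀ x ∈ openCone (p i) (q i), 0 < triple (p (g i)) (q (g i)) x
  disjoint : ∀ i j x, x ∈ openCone (p i) (q i) → x ∈ openCone (p j) (q j) → i = j

namespace DirectedDiagram

variable {ι : Type*} (D : DirectedDiagram ι)

/-- The open cone over the arc `i`. -/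
def cone (i : ι) : Set E3 := openCone (D.p i) (D.q i)

/-- The linear functional which is positive to the left of the arc `i`. -/
def side (i : ι) (x : E3) : ℝ := triple (D.p i) (D.q i) x

theorem side_comb (i : ι) (x y : E3) (s t : ℝ) :
    D.side i (s • x + t • y) = s * D.side i x + t * D.side i y := triple_comb ..

theorem side_p (i : ι) : D.side i (D.p i) = 0 := triple_self_left ..

theorem side_q (i : ι) : D.side i (D.q i) = 0 := triple_self_right ..

theorem side_cone {i : ι} {x : E3} (hx : x ∈ D.cone i) : D.side i x = 0 := by
  obtain ⟨s, t, -, -, rfl⟩ := hx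
  rw [side_comb, side_p, side_q]; ring

/-- The head of `i` lies on the great circle of `f i`, so positivity at `p + q` passes to `p`. -/
theorem side_f_p (i : ι) : 0 < D.side (D.f i) (D.p i) := by
  obtain ⟨s, t, hs, ht, h⟩ := D.q_mem i
  have h1 := D.left_f i ((1 : ℝ) • D.p i + (1 : ℝ) • D.q i) ⟨1, 1, one_pos, one_pos, rfl⟩
  have h2 : D.side (D.f i) (D.q i) = 0 := D.side_cone (D.q_mem i)
  change 0 < D.side _ _ at h1
  rw [side_comb, h2] at h1
  linarith

theorem f_ne (i : ι) : D.f i ≠ i := fun h => by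
  have := D.side_f_p i
  rw [h, side_p] at this
  exact lt_irrefl _ this

/-- The coordinates of the turning point `q i` on the next arc, and the position of the ends of the
next arc with respect to the arc `i`. -/
theorem exists_turn (i : ι) : ∃ s t : ℝ, 0 < s ∧ 0 < t ∧
    D.q i = s • D.p (D.f i) + t • D.q (D.f i) ∧
    D.side i (D.p (D.f i)) = -t * D.side (D.f i) (D.p i) ∧
    D.side i (D.q (D.f i)) = s * D.side (D.f i) (D.p i) := by
  obtain ⟨s, t, hs, ht, h⟩ := D.q_mem i
  refine ⟨s, t, hs, ht, h, ?_, ?_⟩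
  all_goals
    unfold side
    rw [h, triple_comb_mid, triple_self_right]
    simp only [triple_eq]; ring

theorem exists_comb {i : ι} {w : E3} (hw : 0 < D.side i w) {y : E3} (hy : D.side i y = 0) :
    ∃ s t : ℝ, y = s • D.p i + t • D.q i := by
  have h := cramer (D.p i) (D.q i) w y
  unfold side at hw hy
  rw [hy, zero_smul, add_zero] at h
  refine ⟨(triple (D.p i) (D.q i) w)⁻¹ * triple (D.q i) w y,
    (triple (D.p i) (D.q i) w)⁻¹ * triple w (D.p i) y, ?_⟩
  rw [mul_smul, mul_smul, ← smul_add, ← h, inv_smul_smul₀ hw.ne']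

/-! ### Left walks and the region to their left -/

/-- A maximal walk of left turns in the open hemisphere centred at `h`: it comes into the hemisphere
along its first arc, and leaves it along its last one. -/
structure IsLeftWalk (h : E3) (b : ℕ → ι) (m : ℕ) : Prop where
  pos : 0 < m
  step : ∀ k, b (k + 1) = D.f (b k)
  p_zero : inner ℝ h (D.p (b 0)) ≤ 0
  q_pos : ∀ k < m, 0 < inner ℝ h (D.q (b k))
  q_last : inner ℝ h (D.q (b m)) ≤ 0

variable {D}
variable {h : E3} {b : ℕ → ι} {m : ℕ}

namespace IsLeftWalk

/-- A repetition would make the walk periodic, so the last arc, whose head is outside the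
hemisphere, would already occur before index `m`. -/
theorem injOn (W : D.IsLeftWalk h b m) {i j : ℕ} (hij : i < j) (hj : j ≤ m) : b i ≠ b j := by
  intro he
  have hadd : ∀ k, b (i + k) = b (j + k) := fun k => by
    induction k with
    | zero => exact he
    | succ k ih => rw [← add_assoc, ← add_assoc, W.step, W.step, ih]
  have h1 := hadd (m - j)
  have h2 := W.q_pos (i + (m - j)) (by omega)
  rw [h1, show j + (m - j) = m by omega] at h2
  exact absurd W.q_last (not_le.mpr h2)

theorem index_unique (W : D.IsLeftWalk h b m) {i j : ℕ} (hi : i ≤ m) (hj : j ≤ m) {x : E3}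
    (hxi : x ∈ D.cone (b i)) (hxj : x ∈ D.cone (b j)) : i = j := by
  have he := D.disjoint _ _ _ hxi hxj
  rcases lt_trichotomy i j with hlt | heq | hlt
  · exact absurd he (W.injOn hlt hj)
  · exact heq
  · exact absurd he.symm (W.injOn hlt hi)

theorem q_mem_cone (W : D.IsLeftWalk h b m) (k : ℕ) : D.q (b k) ∈ D.cone (b (k + 1)) := by
  rw [W.step]; exact D.q_mem (b k)

/-- Independence of the two ends of an arc is not an axiom of a directed diagram; here it follows
from a neighbouring arc, as `exists_comb` requires. -/
theorem exists_side_pos (W : D.IsLeftWalk h b m) (k : ℕ) : ∃ w, 0 < D.side (b k) w := by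
  cases k with
  | zero =>
    obtain ⟨s, t, hs, ht, -, -, h2⟩ := D.exists_turn (b 0)
    exact ⟨_, by rw [h2]; exact mul_pos hs (D.side_f_p _)⟩
  | succ k => exact ⟨D.p (b k), by rw [W.step]; exact D.side_f_p _⟩

/-- The part of the boundary plane of a side of the walk that is not cut off by the adjacent sides
is covered by the walk. -/
theorem mem_cone_of_side_eq_zero (W : D.IsLeftWalk h b m) {i : ℕ} (hi : i ≤ m) {y : E3}
    (hy : D.side (b i) y = 0) (hhy : 0 < inner ℝ h y)
    (hnext : i < m → 0 ≤ D.side (b (i + 1)) y)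
    (hprev : ∀ j, j + 1 = i → 0 ≤ D.side (b j) y) :
    ∃ k ≤ m, (k = i ∨ k = i + 1) ∧ y ∈ D.cone (b k) := by
  obtain ⟨w, hw⟩ := W.exists_side_pos i
  obtain ⟨s, t, hst⟩ := D.exists_comb hw hy
  have hinner : 0 < s * inner ℝ h (D.p (b i)) + t * inner ℝ h (D.q (b i)) := by
    rw [← inner_comb, ← hst]; exact hhy
  -- `s` measures how far `y` is to the left of the next arc. The last arc has no next one; there,
  -- the head outside the hemisphere takes its place.
  have hs : 0 ≤ s ∧ (s = 0 → i < m) := by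
    rcases hi.lt_or_eq with hlt | rfl
    · refine ⟨?_, fun _ => hlt⟩
      have h1 := hnext hlt
      rw [W.step, hst, side_comb, D.side_cone (D.q_mem (b i)), mul_zero, add_zero] at h1
      exact nonneg_of_mul_nonneg_left h1 (D.side_f_p _)
    · suffices 0 < s from ⟨this.le, fun h0 => absurd h0 this.ne'⟩
      obtain ⟨j, rfl⟩ : ∃ j, i = j + 1 := ⟨i - 1, by have := W.pos; omega⟩
      obtain ⟨σ, τ, hσ, hτ, hq, hsp, hsq⟩ := D.exists_turn (b j)
      rw [← W.step] at hq hsp hsq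
      have hqi : 0 < σ * inner ℝ h (D.p (b (j + 1))) + τ * inner ℝ h (D.q (b (j + 1))) := by
        rw [← inner_comb, ← hq]; exact W.q_pos j (by omega)
      have hp : 0 < inner ℝ h (D.p (b (j + 1))) := by
        have := mul_nonpos_of_nonneg_of_nonpos hτ.le W.q_last
        exact pos_of_mul_pos_right (by linarith : 0 < σ * _) hσ.le
      have h1 := hprev j rfl
      rw [hst, side_comb, hsp, hsq] at h1
      have hd : 0 < D.side (b (j + 1)) (D.p (b j)) := by rw [W.step]; exact D.side_f_p _
      have h2 : 0 ≤ t * σ - s * τ := by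
        refine nonneg_of_mul_nonneg_left (b := D.side (b (j + 1)) (D.p (b j))) ?_ hd
        linarith
      by_contra! hs0
      have h3 := mul_le_mul_of_nonneg_right hs0 hp.le
      have ht : t < 0 := by
        by_contra! ht
        have := mul_nonpos_of_nonneg_of_nonpos ht W.q_last
        linarith
      have h4 := mul_pos_of_neg_of_neg ht (neg_lt_zero.mpr hqi)
      nlinarith [mul_nonneg h2 hp.le]
  -- Being left of the previous arc puts `y` at or past the turning point. For the first arc, the
  -- tail outside the hemisphere is used instead.
  have ht : 0 ≤ t ∧ (0 < s → 0 < t) := by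
    cases i with
    | zero =>
      suffices 0 < t from ⟨this.le, fun _ => this⟩
      have := mul_nonpos_of_nonneg_of_nonpos hs.1 W.p_zero
      exact pos_of_mul_pos_left (by linarith : 0 < t * _) (W.q_pos 0 W.pos).le
    | succ j =>
      obtain ⟨σ, τ, hσ, hτ, hq, hsp, hsq⟩ := D.exists_turn (b j)
      rw [← W.step] at hq hsp hsq
      have h1 := hprev j rfl
      rw [hst, side_comb, hsp, hsq] at h1
      have hd : 0 < D.side (b (j + 1)) (D.p (b j)) := by rw [W.step]; exact D.side_f_p _
      have h2 : 0 ≤ t * σ - s * τ := by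
        refine nonneg_of_mul_nonneg_left (b := D.side (b (j + 1)) (D.p (b j))) ?_ hd
        linarith
      constructor
      · have := mul_nonneg hs.1 hτ.le
        exact nonneg_of_mul_nonneg_left (by linarith : 0 ≤ t * σ) hσ
      · intro h0
        have := mul_pos h0 hτ
        exact pos_of_mul_pos_left (by linarith : 0 < t * σ) hσ.le
  -- If `s = 0`, then `y` is over the head of arc `i`, which is interior to the next arc.
  rcases hs.1.eq_or_lt with h0 | h0
  · have hi' := hs.2 h0.symm
    have ht0 : 0 < t := by
      rw [← h0, zero_mul, zero_add] at hinner
      exact pos_of_mul_pos_left hinner (W.q_pos i hi').le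
    refine ⟨i + 1, hi', Or.inr rfl, ?_⟩
    rw [hst, ← h0, zero_smul, zero_add]
    exact openCone_smul ht0 (W.q_mem_cone i)
  · exact ⟨i, hi, Or.inl rfl, s, t, h0, ht.2 h0, hst⟩

/-- Every arc of the walk is to the left of the later ones, as far as it is in the hemisphere. -/
theorem side_pos_of_lt (W : D.IsLeftWalk h b m) (d : ℕ) : ∀ k, k + d = m → ∀ i, k < i → i ≤ m →
    ∀ x ∈ D.cone (b k), 0 < inner ℝ h x → 0 < D.side (b i) x := by
  induction d with
  | zero => intro k hk i hi him; omega
  | succ d ih =>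
    intro k hk i hi him x hx hhx
    have hq := W.q_pos k (by omega)
    have hk1 : ∀ x ∈ D.cone (b k), 0 < D.side (b (k + 1)) x := fun x hx => by
      rw [W.step]; exact D.left_f (b k) x hx
    have hA0 : D.side (b (k + 1)) (D.q (b k)) = 0 := D.side_cone (W.q_mem_cone k)
    have hA : ∀ j, k + 1 < j → j ≤ m → 0 < D.side (b j) (D.q (b k)) := fun j hj hjm =>
      ih (k + 1) (by omega) j hj hjm _ (W.q_mem_cone k) hq
    by_contra! hneg
    -- Going back from the head of arc `k`, which by induction is weakly left of all later arcs, the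
    -- first crossing would lie on a later arc of the walk, against disjointness.
    obtain ⟨μ, hμ0, hμ1, hall, l, hl, hlB, hl0⟩ := exists_first_zero (Finset.Icc (k + 1) m)
      (fun j => D.side (b j) (D.q (b k))) (fun j => D.side (b j) x)
      (fun j hj => by
        rw [Finset.mem_Icc] at hj
        rcases hj.1.eq_or_lt with rfl | hlt
        · exact hA0.ge
        · exact (hA j hlt hj.2).le)
      ⟨i, Finset.mem_Icc.mpr ⟨hi, him⟩, hneg⟩
    rw [Finset.mem_Icc] at hl
    have hl1 : k + 1 < l := hl.1.lt_of_ne (by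
      rintro rfl
      exact absurd (hk1 x hx) (not_lt.mpr hlB))
    have hμ : 0 < μ := hμ0.lt_of_ne (by
      rintro rfl
      have := hA l hl1 hl.2
      simp only [sub_zero, one_mul, zero_mul, add_zero] at hl0
      linarith)
    have hymem : (1 - μ) • D.q (b k) + μ • x ∈ D.cone (b k) :=
      openCone_segment hμ hμ1 le_rfl zero_le_one (by module) hx
    have hyh : 0 < inner ℝ h ((1 - μ) • D.q (b k) + μ • x) := by
      rw [inner_comb]
      have := mul_nonneg (sub_nonneg.mpr hμ1) hq.le
      have := mul_pos hμ hhx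
      linarith
    obtain ⟨j, hjm, hj, hyj⟩ := W.mem_cone_of_side_eq_zero hl.2
      (y := (1 - μ) • D.q (b k) + μ • x) (by rw [side_comb]; exact hl0) hyh
      (fun hlt => by rw [side_comb]; exact hall (l + 1) (Finset.mem_Icc.mpr ⟨by omega, hlt⟩))
      (fun j hj => by rw [side_comb]; exact hall j (Finset.mem_Icc.mpr ⟨by omega, by omega⟩))
    have := W.index_unique (by omega) hjm hymem hyj
    omega

/-- The open region to the left of the walk. -/
def region (D : DirectedDiagram ι) (h : E3) (b : ℕ → ι) (m : ℕ) : Set E3 :=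
  {x | 0 < inner ℝ h x ∧ ∀ i ≤ m, 0 < D.side (b i) x}

/-- An arc that meets the region to the left of the walk stays in it, within the hemisphere. -/
theorem mem_region_of_mem (W : D.IsLeftWalk h b m) {c : ι} {x y : E3} (hx : x ∈ D.cone c)
    (hxr : x ∈ region D h b m) (hy : y ∈ D.cone c) (hhy : 0 < inner ℝ h y) :
    y ∈ region D h b m := by
  refine ⟨hhy, fun i hi => ?_⟩
  by_contra! hneg
  obtain ⟨μ, hμ0, hμ1, hall, l, hl, -, hl0⟩ := exists_first_zero (Finset.range (m + 1))
    (fun j => D.side (b j) x) (fun j => D.side (b j) y)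
    (fun j hj => (hxr.2 j (by rw [Finset.mem_range] at hj; omega)).le)
    ⟨i, Finset.mem_range.mpr (by omega), hneg⟩
  rw [Finset.mem_range] at hl
  have hμ : 0 < μ := hμ0.lt_of_ne (by
    rintro rfl
    have := hxr.2 l (by omega)
    simp only [sub_zero, one_mul, zero_mul, add_zero] at hl0
    linarith)
  obtain ⟨s, t, hs, ht, hst⟩ := hx
  have hz : (1 - μ) • x + μ • y ∈ D.cone c := openCone_segment hμ hμ1 hs.le ht.le hst hy
  have hzh : 0 < inner ℝ h ((1 - μ) • x + μ • y) := by
    rw [inner_comb]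
    have := mul_nonneg (sub_nonneg.mpr hμ1) hxr.1.le
    have := mul_pos hμ hhy
    linarith
  obtain ⟨j, hjm, -, hzj⟩ := W.mem_cone_of_side_eq_zero (Nat.lt_succ_iff.mp hl)
    (y := (1 - μ) • x + μ • y) (by rw [side_comb]; exact hl0) hzh
    (fun hlt => by rw [side_comb]; exact hall (l + 1) (Finset.mem_range.mpr (by omega)))
    (fun j hj => by rw [side_comb]; exact hall j (Finset.mem_range.mpr (by omega)))
  obtain rfl := D.disjoint _ _ _ hz hzj
  exact absurd (D.side_cone ⟨s, t, hs, ht, hst⟩) (hxr.2 j hjm).ne'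

end IsLeftWalk

/-! ### Moves inside the hemisphere and the minimality argument -/

/-- One can walk along `a` to one of its ends in the open hemisphere centred at `h`, and gets there
to the arc `c`. -/
def Move (D : DirectedDiagram ι) (h : E3) (a c : ι) : Prop :=
  (0 < inner ℝ h (D.q a) ∧ c = D.f a) ∨ (0 < inner ℝ h (D.p a) ∧ c = D.g a)

theorem Move.exists_end {a c : ι} (hm : D.Move h a c) : ∃ e w, (∀ ε : ℝ, 0 < ε →
    (1 : ℝ) • e + ε • w ∈ D.cone a) ∧ 0 < inner ℝ h e ∧ e ∈ D.cone c ∧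
    ∀ x ∈ D.cone a, 0 < D.side c x := by
  rcases hm with ⟨h1, rfl⟩ | ⟨h1, rfl⟩
  · exact ⟨D.q a, D.p a, fun ε hε => ⟨ε, 1, hε, one_pos, add_comm _ _⟩, h1, D.q_mem a, D.left_f a⟩
  · exact ⟨D.p a, D.q a, fun ε hε => ⟨1, ε, one_pos, hε, rfl⟩, h1, D.p_mem a, D.left_g a⟩

namespace IsLeftWalk

/-- Points of `c` close to its end `e` lie in the region: each of the finitely many side conditions
either is open and holds at `e`, or holds on all of `c`. -/
theorem exists_mem_region {c : ι} {e w : E3}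
    (hmem : ∀ ε : ℝ, 0 < ε → (1 : ℝ) • e + ε • w ∈ D.cone c) (he : 0 < inner ℝ h e)
    (hside : ∀ i ≤ m, 0 < D.side (b i) e ∨ ∀ x ∈ D.cone c, 0 < D.side (b i) x) :
    ∃ x ∈ D.cone c, x ∈ region D h b m := by
  have hlin : ∀ A B : ℝ, 0 < A → ∀ᶠ ε : ℝ in nhdsWithin 0 (Set.Ioi 0), 0 < 1 * A + ε * B := by
    intro A B hA
    refine Filter.Eventually.filter_mono nhdsWithin_le_nhds ?_
    have hc : Continuous fun ε : ℝ => 1 * A + ε * B := by fun_prop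
    exact hc.continuousAt.eventually_const_lt (by simpa using hA)
  have hev : ∀ᶠ ε : ℝ in nhdsWithin 0 (Set.Ioi 0), ∀ i ∈ Finset.range (m + 1),
      0 < D.side (b i) ((1 : ℝ) • e + ε • w) := by
    rw [Filter.eventually_all_finset]
    intro i hi
    rcases hside i (by rw [Finset.mem_range] at hi; omega) with hpos | hpos
    · filter_upwards [hlin _ (D.side (b i) w) hpos] with ε hε
      rwa [side_comb]
    · filter_upwards [self_mem_nhdsWithin] with ε hε using hpos _ (hmem ε hε)
  obtain ⟨ε, h1, h2, h3⟩ :=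
    (hev.and ((hlin _ (inner ℝ h w) he).and self_mem_nhdsWithin)).exists
  exact ⟨_, hmem ε h3, by rw [inner_comb]; exact h2,
    fun i hi => h1 i (Finset.mem_range.mpr (by omega))⟩

/-- A walk outside the region to the left of a left walk neither enters this region nor reaches the
first arc of the left walk. -/
theorem outside_of_move (W : D.IsLeftWalk h b m) {c d : ι}
    (hc : ∀ x ∈ D.cone c, x ∉ region D h b m) (hm : D.Move h c d) :
    (∀ x ∈ D.cone d, x ∉ region D h b m) ∧ d ≠ b 0 := by
  obtain ⟨e, w, hmem, he, hed, hside⟩ := hm.exists_end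
  constructor
  · intro x hx hxr
    have her := W.mem_region_of_mem hx hxr hed he
    obtain ⟨z, hz, hzr⟩ := exists_mem_region hmem he (fun i hi => Or.inl (her.2 i hi))
    exact hc z hz hzr
  · rintro rfl
    obtain ⟨z, hz, hzr⟩ := exists_mem_region (b := b) (m := m) hmem he (fun i hi => by
      -- The arc `c` reaches `b 0` from the left, and the meeting point `e`, being on `b 0`, is left
      -- of all later arcs.
      rcases Nat.eq_zero_or_pos i with rfl | hi0
      · exact Or.inr hside
      · exact Or.inl (W.side_pos_of_lt m 0 (zero_add m) i hi0 hi e hed he))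
    exact hc z hz hzr

theorem not_reflTransGen (W : D.IsLeftWalk h b m) :
    ¬ Relation.ReflTransGen (D.Move h) (D.f (b 0)) (b 0) := by
  intro hr
  have key : ∀ c, Relation.ReflTransGen (D.Move h) (D.f (b 0)) c →
      (∀ x ∈ D.cone c, x ∉ region D h b m) ∧ c ≠ b 0 := by
    intro c hc
    induction hc with
    | refl =>
      refine ⟨fun x hx hxr => ?_, D.f_ne _⟩
      rw [← W.step] at hx
      exact absurd (D.side_cone hx) (hxr.2 1 W.pos).ne'
    | tail _ hm ih => exact W.outside_of_move ih.1 hm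
  exact (key _ hr).2 rfl

end IsLeftWalk

theorem Move.active {a c : ι} (hm : D.Move h a c) :
    0 < inner ℝ h (D.p c) ∨ 0 < inner ℝ h (D.q c) := by
  obtain ⟨e, w, -, he, ⟨s, t, hs, ht, rfl⟩, -⟩ := hm.exists_end
  rw [inner_comb] at he
  by_contra! hn
  have := mul_nonpos_of_nonneg_of_nonpos hs.le hn.1
  have := mul_nonpos_of_nonneg_of_nonpos ht.le hn.2
  linarith

/-- If some arc has an end in an open hemisphere, then there is an infinite walk in this hemisphere
which turns always to the left or always to the right. -/
theorem exists_infinite_walk [Finite ι] (D : DirectedDiagram ι) (h : E3)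
    (hne : ∃ c, 0 < inner ℝ h (D.p c) ∨ 0 < inner ℝ h (D.q c)) :
    (∃ c, ∀ n, 0 < inner ℝ h (D.q (D.f^[n] c))) ∨ ∃ c, ∀ n, 0 < inner ℝ h (D.p (D.g^[n] c)) := by
  classical
  by_contra! hcon
  obtain ⟨hf, hg⟩ := hcon
  -- Among arcs with an end in the hemisphere, `c` has the fewest reachable arcs.
  obtain ⟨c, hc, hmin⟩ := Set.exists_min_image
    {c | 0 < inner ℝ h (D.p c) ∨ 0 < inner ℝ h (D.q c)}
    (fun c => {x | Relation.ReflTransGen (D.Move h) c x}.ncard) (Set.toFinite _) hne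
  have hreach : ∀ k, (∀ j < k, 0 < inner ℝ h (D.p (D.g^[j] c))) →
      Relation.ReflTransGen (D.Move h) c (D.g^[k] c) ∧
      (0 < inner ℝ h (D.p (D.g^[k] c)) ∨ 0 < inner ℝ h (D.q (D.g^[k] c))) := by
    intro k
    induction k with
    | zero => exact fun _ => ⟨.refl, hc⟩
    | succ k ih =>
      intro hk
      have hm : D.Move h (D.g^[k] c) (D.g^[k + 1] c) :=
        Or.inr ⟨hk k (Nat.lt_succ_self k), Function.iterate_succ_apply' ..⟩
      exact ⟨(ih fun j hj => hk j (by omega)).1.tail hm, hm.active⟩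
  have hn := Nat.find_spec (hg c)
  obtain ⟨hca, hact⟩ := hreach (Nat.find (hg c)) fun j hj => not_le.mp (Nat.find_min (hg c) hj)
  set a := D.g^[Nat.find (hg c)] c
  have hqa : 0 < inner ℝ h (D.q a) := hact.resolve_left (not_lt.mpr hn)
  have hm : D.Move h a (D.f a) := Or.inl ⟨hqa, rfl⟩
  have W : D.IsLeftWalk h (fun k => D.f^[k] a) (Nat.find (hf a)) :=
    { pos := (Nat.find_pos (hf a)).mpr (not_le.mpr hqa)
      step := fun k => Function.iterate_succ_apply' ..
      p_zero := hn
      q_pos := fun k hk => not_le.mp (Nat.find_min (hf a) hk)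
      q_last := Nat.find_spec (hf a) }
  refine W.not_reflTransGen ?_
  have hsub : {x | Relation.ReflTransGen (D.Move h) (D.f a) x} ⊆
      {x | Relation.ReflTransGen (D.Move h) c x} := fun x hx => (hca.tail hm).trans hx
  -- By minimality of `c`, all that it reaches, including `a`, is reachable from `f a`.
  have heq := Set.eq_of_subset_of_ncard_le hsub (hmin _ hm.active) (Set.toFinite _)
  exact heq.ge hca

/-- `q i` lies on the arc `f i`, all of whose interior is to the left of `f (f i)`. -/
theorem turn_f (i : ι) : 0 < triple (D.q i) (D.q (D.f i)) (D.q (D.f (D.f i))) := by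
  have h1 : 0 < D.side (D.f (D.f i)) (D.q i) := D.left_f _ _ (D.q_mem i)
  obtain ⟨s, t, hs, ht, h3⟩ := D.q_mem (D.f i)
  rw [h3, triple_comb_mid, triple_self_right, triple_rotate]
  have := mul_pos hs h1
  unfold side at this
  linarith

theorem turn_g (i : ι) : triple (D.p i) (D.p (D.g i)) (D.p (D.g (D.g i))) < 0 := by
  have h1 : 0 < D.side (D.g (D.g i)) (D.p i) := D.left_g _ _ (D.p_mem i)
  obtain ⟨s, t, hs, ht, h3⟩ := D.p_mem (D.g i)
  rw [h3, triple_comb_mid, triple_self_right, triple_rotate, triple_swap]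
  have := mul_pos ht h1
  unfold side at this
  linarith

end DirectedDiagram

/-! ### From infinite walks to swirls -/

/-- An infinite walk in an open hemisphere which turns always to the same side runs into a swirl
whose eye is in this hemisphere. -/
theorem exists_swirl {S : Set Arc} [Finite S] (φ : S → S) (e : S → E3) (o : ℝ) (h : E3)
    (ho : o = 1 ∨ o = -1) (he : ∀ a : S, e a ∈ (a : Arc).endpoints)
    (hφ : ∀ a : S, e a ∈ (φ a : Arc).interior)
    (turn : ∀ a : S, 0 < o * triple (e a) (e (φ a)) (e (φ (φ a))))
    (c : S) (hc : ∀ n, 0 < inner ℝ h (e (φ^[n] c))) :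
    ∃ W : Swirl S, W.eye ⊆ openHemisphere h := by
  obtain ⟨i, j, hij, heq⟩ := Finite.exists_ne_map_eq_of_infinite (fun n : ℕ => φ^[n] c)
  wlog hlt : i < j generalizing i j
  · exact this j i hij.symm heq.symm (by omega)
  set d := φ^[i] c with hd
  have hper : Function.IsPeriodicPt φ (j - i) d := by
    change φ^[j - i] (φ^[i] c) = φ^[i] c
    rw [← Function.iterate_add_apply, Nat.sub_add_cancel hlt.le]
    exact heq.symm
  have hdpos : ∀ n, 0 < inner ℝ h (e (φ^[n] d)) := fun n => by
    rw [hd, ← Function.iterate_add_apply]; exact hc _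
  have hmod : ∀ n, φ^[n % Function.minimalPeriod φ d] d = φ^[n] d := fun n =>
    Function.iterate_mod_minimalPeriod_eq
  have hinj := Function.iterate_injOn_Iio_minimalPeriod (f := φ) (x := d)
  have hpos : Function.minimalPeriod φ d ≠ 0 := (hper.minimalPeriod_pos (by omega)).ne'
  -- Taking the minimal period as length makes the arcs of the cycle distinct.
  generalize Function.minimalPeriod φ d = N at hmod hinj hpos
  have : NeZero N := ⟨hpos⟩
  obtain ⟨A, hA⟩ : ∃ A : Fin N → S, ∀ k, A k = φ^[(k : ℕ)] d := ⟨_, fun _ => rfl⟩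
  have hsucc : ∀ k, A (k + 1) = φ (A k) := fun k => by
    rw [hA, hA, Fin.val_add, Fin.val_one', Nat.add_mod_mod, hmod, Function.iterate_succ_apply']
  have ht : ∀ k, 0 < o * triple (e (A k)) (e (A (k + 1))) (e (A (k + 1 + 1))) := fun k => by
    rw [hsucc (k + 1), hsucc k]; exact turn _
  let W : Swirl S :=
    { length := N
      arc := fun k => A k
      arc_mem := fun k => (A k).2
      arc_injective := fun k l hkl => by
        have h1 : A k = A l := Subtype.ext hkl
        rw [hA, hA] at h1
        exact Fin.ext (hinj k.isLt l.isLt h1)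
      tip := fun k => e (A k)
      tip_endpoint := fun k => he _
      tip_interior := fun k => by rw [hsucc]; exact hφ _
      orient := o
      orient_eq := ho
      turn := ht }
  refine ⟨W, fun x hx => ⟨hx.1, ?_⟩⟩
  have hv : ∀ k, 0 < inner ℝ h (e (A k)) := fun k => by rw [hA]; exact hdpos _
  have hxe : ∀ k, 0 ≤ o * triple (e (A k)) (e (A (k + 1))) x := hx.2
  exact inner_pos_of_polygon (fun k => e (A k)) o h x hv ht hxe
    (norm_ne_zero_iff.mp (by rw [hx.1]; exact one_ne_zero))

/-! ### From occlusion diagrams to directed diagrams -/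

theorem Arc.exists_interior_of_openCone (a : Arc) {x : E3} (hx : x ∈ openCone a.fst a.snd) :
    ∃ r : ℝ, 0 < r ∧ r • x ∈ a.interior := by
  have hx0 : x ≠ 0 := by
    rintro rfl
    obtain ⟨s, t, hs, ht, h⟩ := hx
    have h1 : s • a.fst = -(t • a.snd) := eq_neg_of_add_eq_zero_left h.symm
    have h2 := congrArg norm h1
    rw [norm_neg, norm_smul, norm_smul, a.norm_fst, a.norm_snd, mul_one, mul_one,
      Real.norm_of_nonneg hs.le, Real.norm_of_nonneg ht.le] at h2
    rw [h2, ← smul_neg] at h1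
    exact a.ne_neg (smul_right_injective _ ht.ne' h1)
  have hn : 0 < ‖x‖⁻¹ := inv_pos.mpr (norm_pos_iff.mpr hx0)
  refine ⟨‖x‖⁻¹, hn, ?_, openCone_smul hn hx⟩
  rw [norm_smul, norm_inv, norm_norm, inv_mul_cancel₀ (norm_ne_zero_iff.mpr hx0)]

theorem openCone_comm (u v : E3) : openCone u v = openCone v u := by
  ext x
  constructor <;> rintro ⟨s, t, hs, ht, rfl⟩ <;> exact ⟨t, s, ht, hs, add_comm _ _⟩

/-- Every endpoint of an arc of a diagram is in the interior of an arc of the diagram. -/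
theorem IsSOD.exists_mem_interior {S : Set Arc} (hS : IsSOD S) {a : Arc} (ha : a ∈ S) {x : E3}
    (hx : x ∈ a.endpoints) : ∃ b ∈ S, x ∈ b.interior := by
  obtain ⟨b, c, hbc, hset⟩ := Set.ncard_eq_two.mp (hS.feeds_two a ha)
  obtain ⟨hb, y, hy, hyb⟩ : b ∈ {b | b ∈ S ∧ a.FeedsInto b} := by rw [hset]; simp
  obtain ⟨hc, z, hz, hzc⟩ : c ∈ {b | b ∈ S ∧ a.FeedsInto b} := by rw [hset]; simp
  -- Two arcs with disjoint interiors cannot receive the same endpoint, so the two arcs fed into use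
  -- up both ends of `a`.
  have hyz : y ≠ z := by
    rintro rfl
    exact Set.disjoint_left.mp (hS.internally_disjoint b hb c hc hbc) hyb hzc
  have : x = y ∨ x = z := by
    rcases hx with rfl | rfl <;> rcases hy with rfl | rfl <;> rcases hz with rfl | rfl <;> simp_all
  rcases this with rfl | rfl
  exacts [⟨b, hb, hyb⟩, ⟨c, hc, hzc⟩]

theorem IsSOD.exists_direction {S : Set Arc} (hS : IsSOD S) (b : S) : ∃ p q : E3,
    (p = (b : Arc).fst ∧ q = (b : Arc).snd ∨ p = (b : Arc).snd ∧ q = (b : Arc).fst) ∧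
    ∀ a ∈ S, a.FeedsInto b → ∀ x ∈ a.interior, 0 < triple p q x := by
  rcases hS.same_side b b.2 with hl | hr
  · exact ⟨_, _, Or.inl ⟨rfl, rfl⟩, fun a ha hf x hx => hl a ha hf hx⟩
  · refine ⟨_, _, Or.inr ⟨rfl, rfl⟩, fun a ha hf x hx => ?_⟩
    have : triple _ _ _ < 0 := hr a ha hf hx
    rw [triple_swap]
    linarith

theorem IsSOD.exists_directedDiagram {S : Set Arc} (hS : IsSOD S) : ∃ D : DirectedDiagram S,
    (∀ a : S, D.p a ∈ (a : Arc).endpoints ∧ D.q a ∈ (a : Arc).endpoints) ∧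
    (∀ a : S, D.p a ∈ (D.g a : Arc).interior ∧ D.q a ∈ (D.f a : Arc).interior) ∧
    ∀ a : S, ∀ x ∈ (a : Arc).endpoints, x = D.p a ∨ x = D.q a := by
  choose p q hpq hleft using hS.exists_direction
  have hp : ∀ a : S, p a ∈ (a : Arc).endpoints := fun a => by
    rcases hpq a with h | h <;> rw [h.1] <;> simp [Arc.endpoints]
  have hq : ∀ a : S, q a ∈ (a : Arc).endpoints := fun a => by
    rcases hpq a with h | h <;> rw [h.2] <;> simp [Arc.endpoints]
  have hcone : ∀ a : S, openCone (p a) (q a) = openCone (a : Arc).fst (a : Arc).snd := fun a => by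
    rcases hpq a with h | h <;> rw [h.1, h.2]
    exact openCone_comm _ _
  have hg : ∀ a : S, ∃ b : S, p a ∈ (b : Arc).interior := fun a => by
    obtain ⟨b, hb, h⟩ := hS.exists_mem_interior a.2 (hp a)
    exact ⟨⟨b, hb⟩, h⟩
  have hf : ∀ a : S, ∃ b : S, q a ∈ (b : Arc).interior := fun a => by
    obtain ⟨b, hb, h⟩ := hS.exists_mem_interior a.2 (hq a)
    exact ⟨⟨b, hb⟩, h⟩
  choose g hg using hg
  choose f hf using hf
  have hside : ∀ a b : S, (a : Arc).FeedsInto b → ∀ x ∈ openCone (p a) (q a),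
      0 < triple (p b) (q b) x := fun a b hab x hx => by
    obtain ⟨r, hr, hrx⟩ := (a : Arc).exists_interior_of_openCone (hcone a ▸ hx)
    have := hleft b a a.2 hab _ hrx
    rw [triple_smul] at this
    exact pos_of_mul_pos_right this hr.le
  refine ⟨⟨p, q, f, g, fun a => ?_, fun a => ?_, fun a => hside _ _ ⟨_, hq a, hf a⟩,
    fun a => hside _ _ ⟨_, hp a, hg a⟩, fun a b x hxa hxb => ?_⟩, fun a => ⟨hp a, hq a⟩,
    fun a => ⟨hg a, hf a⟩, fun a x hx => ?_⟩
  · rw [hcone]; exact (hf a).2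
  · rw [hcone]; exact (hg a).2
  · by_contra hab
    obtain ⟨r, hr, hrx⟩ := (a : Arc).exists_interior_of_openCone (hcone a ▸ hxa)
    have hdis := hS.internally_disjoint a a.2 b b.2 (fun h => hab (Subtype.ext h))
    exact Set.disjoint_left.mp hdis hrx ⟨hrx.1, openCone_smul hr (hcone b ▸ hxb)⟩
  · change x = p a ∨ x = q a
    rcases hpq a with h | h <;> rw [h.1, h.2]
    exacts [hx, hx.symm]

/-- A unit vector in the open cone of two distinct unit vectors has coefficients with sum greater
than one. -/
theorem one_lt_add_of_unit {u v : E3} (hu : ‖u‖ = 1) (hv : ‖v‖ = 1) (huv : u ≠ v) {s t : ℝ}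
    (hs : 0 < s) (ht : 0 < t) (h : ‖s • u + t • v‖ = 1) : 1 < s + t := by
  have h1 : inner ℝ u v < 1 := by
    refine (real_inner_le_norm u v).trans_eq (by rw [hu, hv, one_mul]) |>.lt_of_ne fun h => huv ?_
    exact (inner_eq_one_iff_of_norm_eq_one hu hv).mp h
  have h2 : ‖s • u + t • v‖ ^ 2 = s ^ 2 + 2 * (s * t) * inner ℝ u v + t ^ 2 := by
    rw [norm_add_sq_real, norm_smul, norm_smul, hu, hv, real_inner_smul_left,
      real_inner_smul_right, mul_one, mul_one, Real.norm_of_nonneg hs.le, Real.norm_of_nonneg ht.le]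
    ring
  rw [h] at h2
  have h3 := mul_pos (mul_pos hs ht) (sub_pos.mpr h1)
  by_contra! hle
  nlinarith

/-- No diagram is contained in a closed hemisphere. -/
theorem IsSOD.exists_inner_pos {S : Set Arc} (hS : IsSOD S) (h : E3) (hh : h ≠ 0) :
    ∃ a ∈ S, ∃ x ∈ a.endpoints, 0 < inner ℝ h x := by
  by_contra! hneg
  have hfst : ∀ a ∈ S, inner ℝ h a.fst ≤ 0 := fun a ha => hneg a ha _ (Or.inl rfl)
  have hsnd : ∀ a ∈ S, inner ℝ h a.snd ≤ 0 := fun a ha => hneg a ha _ (Or.inr rfl)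
  obtain ⟨a, ha, hmax⟩ := Set.exists_max_image S
    (fun a => max (inner ℝ h a.fst : ℝ) (inner ℝ h a.snd)) hS.finite hS.nonempty
  obtain ⟨x, hx, hxmax⟩ : ∃ x ∈ a.endpoints,
      inner ℝ h x = max (inner ℝ h a.fst : ℝ) (inner ℝ h a.snd) := by
    rcases max_choice (inner ℝ h a.fst : ℝ) (inner ℝ h a.snd) with h1 | h1
    exacts [⟨_, Or.inl rfl, h1.symm⟩, ⟨_, Or.inr rfl, h1.symm⟩]
  simp only [← hxmax, max_le_iff] at hmax
  -- A negative maximum is impossible: `x = s • b.fst + t • b.snd` with `s + t > 1`, so its value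
  -- would be at most `s + t` times the maximum, hence below it.
  have hx0 : inner ℝ h x = 0 := by
    obtain ⟨b, hb, hx1, s, t, hs, ht, rfl⟩ := hS.exists_mem_interior ha hx
    have hst := one_lt_add_of_unit b.norm_fst b.norm_snd b.ne hs ht hx1
    refine le_antisymm (hneg a ha _ hx) ?_
    by_contra! hlt
    have h1 := mul_le_mul_of_nonneg_left (hmax b hb).1 hs.le
    have h2 := mul_le_mul_of_nonneg_left (hmax b hb).2 ht.le
    have h3 := mul_neg_of_pos_of_neg (sub_pos.mpr hst) hlt
    have h4 := inner_comb h b.fst b.snd s t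
    linarith
  have hzero : ∀ b ∈ S, ∀ y ∈ b.interior, inner ℝ h y = 0 →
      inner ℝ h b.fst = 0 ∧ inner ℝ h b.snd = 0 := by
    rintro b hb y ⟨-, s, t, hs, ht, rfl⟩ hy
    rw [inner_comb] at hy
    have h1 := mul_nonpos_of_nonneg_of_nonpos hs.le (hfst b hb)
    have h2 := mul_nonpos_of_nonneg_of_nonpos ht.le (hsnd b hb)
    exact ⟨(mul_eq_zero.mp (by linarith : s * inner ℝ h b.fst = 0)).resolve_left hs.ne',
      (mul_eq_zero.mp (by linarith : t * inner ℝ h b.snd = 0)).resolve_left ht.ne'⟩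
  -- The arc `b` through `x` lies in the plane orthogonal to `h`, and so does the arc `c` that it
  -- feeds into. Then `b` cannot be strictly to one side of `c`.
  obtain ⟨b, hb, hxb⟩ := hS.exists_mem_interior ha hx
  obtain ⟨hb1, hb2⟩ := hzero b hb x hxb hx0
  obtain ⟨c, hc, hbc⟩ := hS.exists_mem_interior hb (Or.inl rfl)
  obtain ⟨hc1, hc2⟩ := hzero c hc _ hbc hb1
  have hxh := triple_eq_zero_of_inner_eq_zero hh hc1 hc2 hx0
  rcases hS.same_side c hc with hl | hr
  · exact (hl b hb ⟨_, Or.inl rfl, hbc⟩ hxb : 0 < triple _ _ _).ne' hxh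
  · exact (hr b hb ⟨_, Or.inl rfl, hbc⟩ hxb : triple _ _ _ < 0).ne hxh

end SphericalOcclusion

theorem lemma6 (S : Set SphericalOcclusion.Arc) (hS : SphericalOcclusion.IsSOD S)
    (h : SphericalOcclusion.E3) (hh : ‖h‖ = 1) :
    ∃ W : SphericalOcclusion.Swirl S, W.eye ⊆ SphericalOcclusion.openHemisphere h := by
  obtain ⟨D, hend, hint, hends⟩ := hS.exists_directedDiagram
  have : Finite S := hS.finite
  obtain ⟨a, ha, x, hx, hpos⟩ := hS.exists_inner_pos h (norm_ne_zero_iff.mp (by simp [hh]))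
  have hne : ∃ c, 0 < inner ℝ h (D.p c) ∨ 0 < inner ℝ h (D.q c) := by
    refine ⟨⟨a, ha⟩, ?_⟩
    rcases hends ⟨a, ha⟩ x hx with h1 | h1
    exacts [Or.inl (h1 ▸ hpos), Or.inr (h1 ▸ hpos)]
  rcases D.exists_infinite_walk h hne with ⟨c, hc⟩ | ⟨c, hc⟩
  · exact SphericalOcclusion.exists_swirl D.f D.q 1 h (Or.inl rfl) (fun a => (hend a).2)
      (fun a => (hint a).2) (fun a => by rw [one_mul]; exact D.turn_f a) c hc
  · exact SphericalOcclusion.exists_swirl D.g D.p (-1) h (Or.inr rfl) (fun a => (hend a).1)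
      (fun a => (hint a).1) (fun a => by linarith [D.turn_g a]) c hc
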